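/- Define the Fibonacci polynomials $F_n(x)\in\mathbb{R}[x]$, $n\in\mathbb{Z}$, by $F_0(x)=0$, $F_1(x)=1$ and $F_{n+2}(x)=xF_{n+1}(x)+F_n(x)$ for all $n\in\mathbb{Z}$ (used backwards for negative indices). For integers $n,t$ let $F_n(x)^{\langle t\rangle}=F_n(x)F_{n+1}(x)\cdots F_{n+t-1}(x)$, the empty product $1$ if $t\le 0$. Let $m\ge 1$ and $d\ge 1$ be integers, let $s,k,n$ be any integers, and let $(d_i)_{1\le i\le m}$ and $(e_i)_{1\le i\le m}$ be sequences of integers. Then the following hold. 1. $$\det\big([F_{s+k(n+i+j)}(x)^m]_{0\le i,j\le m}\big)=(-1)^{(s+kn+1)\binom{m+1}{2}}\prod_{i=0}^m\binom{m}{i}F_{(i+1)k}(x)^{2(m-i)}.$$ 2. $$\det\Big(\Big[\prod_{f=j+1}^m F_{s+k(n+i+d_f)}(x)\prod_{g=1}^j F_{s+k(n+i+e_g)}(x)\Big]_{0\le i,j\le m}\Big)=(-1)^{(s+kn+1)\binom{m+1}{2}+k\binom{m+1}{3}}\prod_{l=1}^m F_{kl}(x)^{m+1-l}\cdot\prod_{1\le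 i\le j\le m}(-1)^{kd_j}F_{k(e_i-d_j)}(x).$$ 3. $$\det\Big(\Big[\frac{1}{F_{s+k(n+i+j)}(x)}\Big]_{0\le i,j\le m}\Big)=\frac{(-1)^{(s+kn)\binom{m+1}{2}}\prod_{i=0}^m F_{k(i+1)}(x)^{2(m-i)}}{\prod_{0\le i,j\le m}F_{s+k(n+i+j)}(x)},$$ provided that the denominators are nonzero; this holds both in the field $\mathbb{R}(x)$ of rational functions (if no polynomial $F_{s+k(n+i+j)}$, $0\le i,j\le m$, is zero) and at every real number $x$ at which none of the $F_{s+k(n+i+j)}(x)$ vanishes. 4. $$\det\big([F_{n+i+j}(x)^{\langle m\rangle}]_{0\le i,j\le d-1}\big)=(-1)^{n\binom{d}{2}+\binom{d+1}{3}}\prod_{i=1}^{d-1}\big(F_i(x)F_{m+1-i}(x)\big)^{d-i}\cdot\prod_{i=d-1}^{2(d-1)}F_{n+i}(x)^{\langle m+1-d\rangle}.$$ In particular, for the Fibonacci numbers $F_n=F_n(1)$ and all integers $n\ge1$, $$\det\Big(\Big[\frac{1}{F_{n+i+j}}\Big]_{0\le i,j\le m}\Big)=\frac{(-1)^{n\binom{m+1}{2}}\prod_{i=0}^m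 F_{i+1}^{2(m-i)}}{\prod_{0\le i,j\le m}F_{n+i+j}}.$$ -/

import Mathlib

open Polynomial

/-- The Fibonacci polynomials `F_n(x)`, `n ∈ ℤ`, with real coefficients: `F_0 = 0`, `F_1 = 1`,
`F_{n+2} = x F_{n+1} + F_n`, and for negative indices `F_n = F_{n+2} - x F_{n+1}`. -/
noncomputable def fibPoly : ℤ → ℝ[X]
  | 0 => 0
  | 1 => 1
  | (n : ℕ) + 2 => X * fibPoly (n + 1) + fibPoly n
  | -((n : ℕ) + 1) => -X * fibPoly (-n) + fibPoly (-n + 1)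
  termination_by n => Int.natAbs n + Int.natAbs (n - 1)

theorem fibPoly_zero : fibPoly 0 = 0 := by rw [fibPoly]

theorem fibPoly_one : fibPoly 1 = 1 := by rw [fibPoly]

/-- The recurrence holds for every integer index. -/
theorem fibPoly_add_two : ∀ n : ℤ, fibPoly (n + 2) = X * fibPoly (n + 1) + fibPoly n
  | (n : ℕ) => fibPoly.eq_3 n
  | -(n + 1 : ℕ) => by
    have h := fibPoly.eq_4 n
    rw [Int.negSucc_eq] at h
    have h1 : -((n + 1 : ℕ) : ℤ) + 2 = -(n : ℤ) + 1 := by omega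
    have h2 : -((n + 1 : ℕ) : ℤ) + 1 = -(n : ℤ) := by omega
    rw [h1, h2, Nat.cast_succ, h]
    ring

/-- The rising power `F_n^{⟨t⟩} = F_n F_{n+1} ⋯ F_{n+t-1}` of the Fibonacci polynomials;
the product is empty (equal to `1`) for `t ≤ 0`. -/
noncomputable def fibPolyRising (n t : ℤ) : ℝ[X] :=
  ∏ i ∈ Finset.range t.toNat, fibPoly (n + i)

/-- The sign `(-1)^e` for an integer exponent `e`, as a constant polynomial. -/
noncomputable def polySign (e : ℤ) : ℝ[X] := C ((-1 : ℝ) ^ e)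

/-! By the addition formula `fibPoly_add`, F_{a+t} is a linear form in the pair (F_a, F_{a+1}) with
coefficients depending only on t. With a = s + k(n+i), the power, product and rising-power matrices
therefore have entries P_j(x_i, y_i), where P_j is a binary form of degree m and (x_i, y_i) is a
pair of consecutive Fibonacci polynomials. For m + 1 rows such a determinant is the projective
Vandermonde product of the x_i y_j - y_i x_j, each of which is ±F_{k(j-i)} by
`fibPoly_bracket_translate`, times a factor depending only on the forms. For powers the binomial
theorem gives that factor (`det_pow_linear`); for products it is found by evaluating at zeros of the
linear forms (`det_prod_linear`). Reciprocals reduce to products by clearing denominators in each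
row. Rising powers with d ≤ m + 1 reduce to products by extracting a common factor from each row;
for d > m + 1 both sides vanish. -/

/-! ### Reindexing of products over pairs. -/

theorem prod_Ioi_eq_prod_range {M : Type*} [CommMonoid M] (h : ℕ → ℕ → M) (m : ℕ) :
    ∏ i : Fin m, ∏ j ∈ Finset.Ioi i, h i j =
      ∏ j ∈ Finset.range m, ∏ i ∈ Finset.range j, h i j := by
  rw [Finset.prod_comm' (t' := Finset.univ) (s' := fun j => Finset.Iio j) (by simp),
    ← Fin.prod_univ_eq_prod_range (fun j => ∏ i ∈ Finset.range j, h i j)]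
  refine Finset.prod_congr rfl fun j _ => ?_
  rw [← Nat.Iio_eq_range, ← Fin.map_valEmbedding_Iio, Finset.prod_map]
  rfl

theorem prod_Icc_one_eq_prod_range {M : Type*} [CommMonoid M] (g : ℕ → M) (j : ℕ) :
    ∏ i ∈ Finset.Icc 1 j, g i = ∏ i ∈ Finset.range j, g (i + 1) := by
  induction j with
  | zero => simp
  | succ j ih => rw [Finset.prod_Icc_succ_top (by omega), ih, Finset.prod_range_succ]

theorem prod_Icc_Icc_eq_prod_range {M : Type*} [CommMonoid M] (h : ℕ → ℕ → M) (m : ℕ) :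
    ∏ j ∈ Finset.Icc 1 m, ∏ i ∈ Finset.Icc 1 j, h i j =
      ∏ j ∈ Finset.range (m + 1), ∏ i ∈ Finset.range j, h (i + 1) j := by
  simp only [prod_Icc_one_eq_prod_range]
  rw [Finset.prod_range_succ']
  simp

/-! ### Alternants of binary forms over a commutative ring. -/

/-- `P` is a binary form of degree `D` over `R`. -/
def IsBinaryForm {R : Type*} [CommRing R] (D : ℕ) (P : R → R → R) : Prop :=
  ∃ c : ℕ → R, (∀ l, D < l → c l = 0) ∧
    ∀ x y, P x y = ∑ l ∈ Finset.range (D + 1), c l * (y ^ l * x ^ (D - l))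

section
variable {R : Type*} [CommRing R]

theorem IsBinaryForm.one : IsBinaryForm (R := R) 0 (fun _ _ => 1) :=
  ⟨fun l => if l = 0 then 1 else 0, fun l hl => if_neg (by omega), fun x y => by simp⟩

theorem IsBinaryForm.mul_linear {D : ℕ} {P : R → R → R} (h : IsBinaryForm D P) (a b : R) :
    IsBinaryForm (D + 1) (fun x y => P x y * (a * x + b * y)) := by
  obtain ⟨c, hc, hP⟩ := h
  -- Multiplication by `b * y` shifts the coefficients by one. The vanishing of `c` beyond `D`
  -- removes the term `l = D + 1` from the `a * x` part.
  refine ⟨fun l => a * c l + b * (if l = 0 then 0 else c (l - 1)), fun l hl => ?_, fun x y => ?_⟩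
  · dsimp only
    rw [hc l (by omega), hc (l - 1) (by omega)]
    simp
  · simp only [add_mul, Finset.sum_add_distrib, hP]
    rw [mul_add, Finset.sum_mul, Finset.sum_mul]
    congr 1
    · rw [Finset.sum_range_succ _ (D + 1), hc (D + 1) (by omega)]
      simp only [mul_zero, zero_mul, add_zero]
      refine Finset.sum_congr rfl fun l hl => ?_
      have : D + 1 - l = (D - l) + 1 := by have := Finset.mem_range.1 hl; omega
      rw [this]
      ring
    · rw [Finset.sum_range_succ' _ (D + 1)]
      simp only [Nat.add_sub_add_right, Nat.add_sub_cancel]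
      simp only [Nat.succ_ne_zero, if_false, if_true, mul_zero, zero_mul, add_zero]
      refine Finset.sum_congr rfl fun l hl => ?_
      ring

theorem IsBinaryForm.mul_prod_linear {ι : Type*} {D : ℕ} {P : R → R → R} (h : IsBinaryForm D P)
    (S : Finset ι) (a b : ι → R) :
    IsBinaryForm (D + S.card) (fun x y => P x y * ∏ f ∈ S, (a f * x + b f * y)) := by
  classical
  induction S using Finset.induction_on with
  | empty => simpa using h
  | insert f S hf ih =>
    rw [Finset.card_insert_of_notMem hf]
    have := ih.mul_linear (a f) (b f)
    simp only [Finset.prod_insert hf]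
    rw [← Nat.add_assoc]
    convert this using 3
    ring

theorem IsBinaryForm.prod_linear {ι : Type*} (S : Finset ι) (a b : ι → R) :
    IsBinaryForm S.card (fun x y => ∏ f ∈ S, (a f * x + b f * y)) := by
  simpa using IsBinaryForm.one.mul_prod_linear S a b

/-- An alternant of binary forms of degree `m` is a multiple of the projective Vandermonde
determinant, the factor depending only on the forms. -/
theorem exists_det_binaryForm (m : ℕ) (P : ℕ → R → R → R)
    (hP : ∀ j ≤ m, IsBinaryForm m (P j)) :
    ∃ K : R, ∀ x y : ℕ → R,
      Matrix.det (Matrix.of fun i j : Fin (m + 1) => P j (x i) (y i)) =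
        (∏ j ∈ Finset.range (m + 1), ∏ i ∈ Finset.range j, (x i * y j - y i * x j)) * K := by
  have hP' : ∀ j : Fin (m + 1), IsBinaryForm m (P j) := fun j => hP j (by omega)
  choose c _ hcP using hP'
  refine ⟨Matrix.det (Matrix.of fun l j : Fin (m + 1) => c j l), fun x y => ?_⟩
  have : (Matrix.of fun i j : Fin (m + 1) => P j (x i) (y i)) =
      Matrix.projVandermonde (fun i : Fin (m + 1) => y i) (fun i => x i) *
        Matrix.of fun l j : Fin (m + 1) => c j l := by
    ext i j
    rw [Matrix.mul_apply, Matrix.of_apply, hcP, Finset.sum_range]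
    refine Finset.sum_congr rfl fun l _ => ?_
    rw [Matrix.projVandermonde_apply, Matrix.of_apply, Fin.val_rev, mul_comm]
    congr 3
    omega
  rw [this, Matrix.det_mul, Matrix.det_projVandermonde, ← prod_Ioi_eq_prod_range (fun i j => x i * y j - y i * x j)]
  congr 1
  refine Finset.prod_congr rfl fun i _ => Finset.prod_congr rfl fun j _ => ?_
  ring

/-- Alternants of binary forms of too small degree vanish. -/
theorem det_binaryForm_eq_zero {m d : ℕ} (h : m + 1 < d) (P : ℕ → R → R → R)
    (hP : ∀ j, IsBinaryForm m (P j)) (x y : ℕ → R) :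
    Matrix.det (Matrix.of fun i j : Fin d => P j (x i) (y i)) = 0 := by
  choose c hc hcP using hP
  -- The monomial matrix is padded to size `d` by zero columns; column `m + 1` is one of them.
  have : (Matrix.of fun i j : Fin d => P j (x i) (y i)) =
      (Matrix.of fun i l : Fin d => if (l : ℕ) < m + 1 then y i ^ (l : ℕ) * x i ^ (m - l) else 0) *
        Matrix.of fun l j : Fin d => c j l := by
    ext i j
    rw [Matrix.mul_apply, Matrix.of_apply, hcP]
    simp only [Matrix.of_apply]
    rw [Fin.sum_univ_eq_sum_range
      (fun l => (if l < m + 1 then y i ^ l * x i ^ (m - l) else 0) * c j l) d,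
      ← Finset.sum_subset (Finset.range_subset_range.2 h.le)]
    · refine Finset.sum_congr rfl fun l hl => ?_
      rw [if_pos (Finset.mem_range.1 hl), mul_comm]
    · intro l _ hl
      rw [if_neg (by simpa using hl), zero_mul]
  rw [this, Matrix.det_mul, Matrix.det_eq_zero_of_column_eq_zero (⟨m + 1, h⟩ : Fin d), zero_mul]
  intro i
  simp

/-- The factor `K` does not depend on the points, so it can be computed at (-b_i, a_i), the zero of
the i-th linear form. There the entries with j < i contain the vanishing factor f = i, and the
matrix is upper triangular. Hypothesis `h` makes the Vandermonde product at these points nonzero, so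
it can be cancelled. -/
theorem det_prod_linear_of_isDomain [IsDomain R] (m : ℕ) (a b a' b' x y : ℕ → R)
    (h : ∀ i j, i < j → a i * b j - b i * a j ≠ 0) :
    Matrix.det (Matrix.of fun i j : Fin (m + 1) =>
        (∏ f ∈ Finset.Icc ((j : ℕ) + 1) m, (a f * x i + b f * y i)) *
          ∏ g ∈ Finset.Icc 1 (j : ℕ), (a' g * x i + b' g * y i)) =
      (∏ j ∈ Finset.range (m + 1), ∏ i ∈ Finset.range j, (x i * y j - y i * x j)) *
        ∏ j ∈ Finset.Icc 1 m, ∏ i ∈ Finset.Icc 1 j, (a j * b' i - b j * a' i) := by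
  obtain ⟨K, hK⟩ := exists_det_binaryForm m
    (fun j x y => (∏ f ∈ Finset.Icc (j + 1) m, (a f * x + b f * y)) *
          ∏ g ∈ Finset.Icc 1 j, (a' g * x + b' g * y)) (fun j hj => by
      have := (IsBinaryForm.prod_linear (Finset.Icc (j + 1) m) a b).mul_prod_linear
        (Finset.Icc 1 j) a' b'
      simp only [Nat.card_Icc] at this
      convert this using 1
      omega)
  rw [hK x y]
  congr 1
  have hK' := hK (fun i => - b i) a
  have hne : (∏ j ∈ Finset.range (m + 1), ∏ i ∈ Finset.range j, (- b i * a j - a i * - b j)) ≠ 0 := by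
    refine Finset.prod_ne_zero_iff.2 fun j _ => Finset.prod_ne_zero_iff.2 fun i hi => ?_
    have e : - b i * a j - a i * - b j = a i * b j - b i * a j := by ring
    rw [e]
    exact h i j (Finset.mem_range.1 hi)
  refine mul_left_cancel₀ hne (hK'.symm.trans ?_)
  rw [Matrix.det_of_isUpperTriangular]
  · simp only [Matrix.of_apply]
    rw [Finset.prod_mul_distrib, Fin.prod_univ_eq_prod_range
      (fun i => ∏ f ∈ Finset.Icc (i + 1) m, (a f * - b i + b f * a i)),
      Fin.prod_univ_eq_prod_range (fun i => ∏ g ∈ Finset.Icc 1 i, (a' g * - b i + b' g * a i))]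
    -- The first factors on the diagonal reproduce the Vandermonde product; the second ones give
    -- `K`.
    congr 1
    · rw [Finset.prod_comm' (t' := Finset.range (m + 1)) (s' := fun j => Finset.range j)]
      · refine Finset.prod_congr rfl fun i _ => Finset.prod_congr rfl fun j _ => ?_
        ring
      · intro i j
        simp only [Finset.mem_range, Finset.mem_Icc]
        omega
    · rw [Finset.prod_range_succ', Finset.Icc_eq_empty (by omega), Finset.prod_empty, mul_one,
        Finset.range_eq_Ico, Finset.prod_Ico_add' (fun i => ∏ g ∈ Finset.Icc 1 i, (a' g * - b i + b' g * a i)) 0 m 1]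
      have : Finset.Ico (0 + 1) (m + 1) = Finset.Icc 1 m := rfl
      rw [this]
      refine Finset.prod_congr rfl fun i _ => Finset.prod_congr rfl fun j _ => ?_
      ring
  · intro i j hij
    have hij : (j : ℕ) < i := hij
    rw [Matrix.of_apply, Finset.prod_eq_zero (i := (i : ℕ)), zero_mul]
    · simp only [Finset.mem_Icc]; omega
    · ring

/-- A homogeneous form of Krattenthaler's determinant evaluation. -/
theorem det_prod_linear (m : ℕ) (a b a' b' x y : ℕ → R) :
    Matrix.det (Matrix.of fun i j : Fin (m + 1) =>
        (∏ f ∈ Finset.Icc ((j : ℕ) + 1) m, (a f * x i + b f * y i)) *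
          ∏ g ∈ Finset.Icc 1 (j : ℕ), (a' g * x i + b' g * y i)) =
      (∏ j ∈ Finset.range (m + 1), ∏ i ∈ Finset.range j, (x i * y j - y i * x j)) *
        ∏ j ∈ Finset.Icc 1 m, ∏ i ∈ Finset.Icc 1 j, (a j * b' i - b j * a' i) := by
  -- The identity is universal: it holds for indeterminates over ℤ, where the nondegeneracy
  -- condition is automatic, and is then specialised along `φ`.
  let Z (t : Fin 6) (i : ℕ) : MvPolynomial (Fin 6 × ℕ) ℤ := MvPolynomial.X (t, i)
  let φ : MvPolynomial (Fin 6 × ℕ) ℤ →+* R :=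
    MvPolynomial.eval₂Hom (Int.castRingHom R) fun p => ![a p.2, b p.2, a' p.2, b' p.2, x p.2, y p.2] p.1
  have key := det_prod_linear_of_isDomain m (Z 0) (Z 1) (Z 2) (Z 3) (Z 4) (Z 5) (by
    intro i j hij h0
    -- Setting a_i = b_j = 1 and all other variables to 0 gives a_i b_j - b_i a_j = 1.
    have := congrArg (MvPolynomial.eval fun p : Fin 6 × ℕ =>
      if p = (0, i) ∨ p = (1, j) then (1 : ℤ) else 0) h0
    simp [Z, hij.ne] at this)
  have h0 (i) : φ (Z 0 i) = a i := by simp [φ, Z]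
  have h1 (i) : φ (Z 1 i) = b i := by simp [φ, Z]
  have h2 (i) : φ (Z 2 i) = a' i := by simp [φ, Z]
  have h3 (i) : φ (Z 3 i) = b' i := by simp [φ, Z]
  have h4 (i) : φ (Z 4 i) = x i := by simp [φ, Z]
  have h5 (i) : φ (Z 5 i) = y i := by simp [φ, Z]
  have := congrArg φ key
  rw [RingHom.map_det] at this
  simp only [map_mul, map_prod, map_sub, h0, h1, h2, h3, h4, h5] at this
  rw [← this]
  congr 1
  ext i j
  simp only [RingHom.mapMatrix_apply, Matrix.map_apply, Matrix.of_apply, map_mul, map_prod, map_add, h0, h1, h2, h3, h4, h5]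

/-- The determinant of `m`-th powers of linear forms. -/
theorem det_pow_linear (m : ℕ) (a b x y : ℕ → R) :
    Matrix.det (Matrix.of fun i j : Fin (m + 1) => (a j * x i + b j * y i) ^ m) =
      (∏ i ∈ Finset.range (m + 1), (m.choose i : R)) *
        (∏ j ∈ Finset.range (m + 1), ∏ i ∈ Finset.range j, (x i * y j - y i * x j)) *
        ∏ j ∈ Finset.range (m + 1), ∏ i ∈ Finset.range j, (a i * b j - b i * a j) := by
  -- The binomial theorem factors the matrix as Vandermonde, diagonal of binomials, transposed
  -- Vandermonde.
  have : (Matrix.of fun i j : Fin (m + 1) => (a j * x i + b j * y i) ^ m) =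
      Matrix.projVandermonde (fun i : Fin (m + 1) => y i) (fun i => x i) *
        Matrix.diagonal (fun l : Fin (m + 1) => (m.choose l : R)) *
        (Matrix.projVandermonde (fun i : Fin (m + 1) => b i) (fun i => a i)).transpose := by
    ext i j
    rw [Matrix.mul_apply, Matrix.of_apply, add_comm, add_pow, Finset.sum_range]
    refine Finset.sum_congr rfl fun l _ => ?_
    have hl : m + 1 - ((l : ℕ) + 1) = m - l := by omega
    rw [Matrix.mul_diagonal, Matrix.transpose_apply, Matrix.projVandermonde_apply,
      Matrix.projVandermonde_apply, Fin.val_rev, hl, mul_pow, mul_pow]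
    ring
  rw [this, Matrix.det_mul, Matrix.det_mul, Matrix.det_transpose, Matrix.det_projVandermonde,
    Matrix.det_projVandermonde, Matrix.det_diagonal,
    ← prod_Ioi_eq_prod_range (fun i j => x i * y j - y i * x j),
    ← prod_Ioi_eq_prod_range (fun i j => a i * b j - b i * a j),
    Fin.prod_univ_eq_prod_range (fun l => (m.choose l : R)), mul_comm (Finset.prod Finset.univ _) (Finset.prod (Finset.range _) _)]
  congr 1
  · congr 1
    refine Finset.prod_congr rfl fun i _ => Finset.prod_congr rfl fun j _ => ?_
    ring
  · refine Finset.prod_congr rfl fun i _ => Finset.prod_congr rfl fun j _ => ?_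
    ring
end

/-! ### Signs and identities for Fibonacci polynomials. -/

theorem polySign_zero : polySign 0 = 1 := by simp [polySign]

theorem polySign_add (a b : ℤ) : polySign (a + b) = polySign a * polySign b := by
  rw [polySign, zpow_add₀ (by norm_num), C_mul]; rfl

theorem polySign_one : polySign 1 = -1 := by simp [polySign]

theorem polySign_mul_self (a : ℤ) : polySign a * polySign a = 1 := by
  rw [← polySign_add, polySign, Even.neg_one_zpow ⟨a, rfl⟩, C_1]

theorem polySign_add_even (a b : ℤ) : polySign (a + 2 * b) = polySign a := by
  rw [two_mul, polySign_add, polySign_add, polySign_mul_self, mul_one]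

theorem polySign_eq_of_sub_eq {a b : ℤ} (c : ℤ) (h : a - b = 2 * c) : polySign a = polySign b := by
  rw [show a = b + 2 * c by omega, polySign_add_even]

theorem polySign_sum {ι : Type*} (s : Finset ι) (f : ι → ℤ) :
    ∏ i ∈ s, polySign (f i) = polySign (∑ i ∈ s, f i) := by
  classical
  induction s using Finset.induction_on with
  | empty => simp [polySign_zero]
  | insert a s ha ih => rw [Finset.prod_insert ha, Finset.sum_insert ha, polySign_add, ih]

/-- The left side is a 2×2 determinant of consecutive pairs. Raising `a` by one applies to both
pairs the same linear map, of determinant -1, and at a = 0 the value is F_c. -/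
theorem fibPoly_bracket (c : ℤ) (a : ℤ) :
    fibPoly (a + c) * fibPoly (a + 1) - fibPoly (a + c + 1) * fibPoly a =
      polySign a * fibPoly c := by
  induction a with
  | zero => simp [fibPoly_zero, fibPoly_one, polySign_zero]
  | succ i ih =>
    have h1 := fibPoly_add_two i
    have h2 := fibPoly_add_two (i + c)
    rw [show (i : ℤ) + 1 + 1 = i + 2 by ring, show (i : ℤ) + 1 + c + 1 = i + c + 2 by ring,
      show (i : ℤ) + 1 + c = i + c + 1 by ring, h1, h2, polySign_add, polySign_one]
    linear_combination -ih
  | pred i ih =>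
    have h1 := fibPoly_add_two (-i - 1)
    have h2 := fibPoly_add_two (-i - 1 + c)
    rw [show -(i : ℤ) - 1 + 2 = -i + 1 by ring, show -(i : ℤ) - 1 + 1 = -i by ring] at h1
    rw [show -(i : ℤ) - 1 + c + 2 = -i + c + 1 by ring, show -(i : ℤ) - 1 + c + 1 = -i + c by ring] at h2
    rw [h1, h2] at ih
    have h3 : polySign (-i : ℤ) = - polySign (-i - 1) := by
      rw [show (-i : ℤ) = (-i - 1) + 1 by ring, polySign_add, polySign_one]; simp
    rw [h3] at ih
    rw [show -(i : ℤ) - 1 + c + 1 = -i + c by ring, show -(i : ℤ) - 1 + 1 = -i by ring]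
    linear_combination -ih

theorem fibPoly_neg (a : ℤ) : fibPoly (-a) = polySign (a + 1) * fibPoly a := by
  have h := fibPoly_bracket (-a) a
  rw [add_neg_cancel, fibPoly_zero, zero_add, fibPoly_one] at h
  rw [polySign_add, polySign_one]
  have h2 := polySign_mul_self a
  linear_combination (-polySign a) * h - fibPoly (-a) * h2

theorem fibPoly_neg_one : fibPoly (-1) = 1 := by
  rw [fibPoly_neg, fibPoly_one, polySign, Even.neg_one_zpow ⟨1, rfl⟩]; simp

/-- Addition formula for Fibonacci polynomials. -/
theorem fibPoly_add (a t : ℤ) :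
    fibPoly (a + t) = fibPoly (t - 1) * fibPoly a + fibPoly t * fibPoly (a + 1) := by
  -- The recurrence has order two, so the induction carries two consecutive values of `t`.
  have aux (t : ℤ) : fibPoly (a + t) = fibPoly (t - 1) * fibPoly a + fibPoly t * fibPoly (a + 1) ∧
      fibPoly (a + t + 1) = fibPoly t * fibPoly a + fibPoly (t + 1) * fibPoly (a + 1) := by
    induction t with
    | zero => simp [fibPoly_zero, fibPoly_one, fibPoly_neg_one]
    | succ i ih =>
      have h1 := fibPoly_add_two (a + i)
      have h2 := fibPoly_add_two i
      rw [show a + ((i : ℤ) + 1) + 1 = a + i + 2 by ring, show a + ((i : ℤ) + 1) = a + i + 1 by ring,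
        show (i : ℤ) + 1 - 1 = i by ring, show (i : ℤ) + 1 + 1 = i + 2 by ring]
      have h3 := fibPoly_add_two ((i : ℤ) - 1)
      rw [show (i : ℤ) - 1 + 2 = i + 1 by ring, show (i : ℤ) - 1 + 1 = i by ring] at h3
      refine ⟨ih.2, ?_⟩
      rw [h1, h2, ih.1, ih.2, h3]
      ring
    | pred i ih =>
      have h1 := fibPoly_add_two (a + (-i - 1))
      have h2 := fibPoly_add_two (-i - 1)
      have h3 := fibPoly_add_two (-i - 1 - 1)
      rw [show a + (-(i : ℤ) - 1) + 2 = a + -i + 1 by ring,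
        show a + (-(i : ℤ) - 1) + 1 = a + -i by ring] at h1
      rw [show -(i : ℤ) - 1 + 2 = -i + 1 by ring, show -(i : ℤ) - 1 + 1 = -i by ring] at h2
      rw [show -(i : ℤ) - 1 - 1 + 2 = -i by ring, show -(i : ℤ) - 1 - 1 + 1 = -i - 1 by ring] at h3
      rw [show a + (-(i : ℤ) - 1) + 1 = a + -i by ring, show -(i : ℤ) - 1 + 1 = -i by ring]
      refine ⟨?_, ih.1⟩
      linear_combination ih.2 - X * ih.1 - h1 + fibPoly a * h3 + fibPoly (a + 1) * h2
  exact (aux t).1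

/-- The bracket of two translates of the Fibonacci polynomials. -/
theorem fibPoly_bracket_translate (p q : ℤ) :
    fibPoly p * fibPoly (q + 1) - fibPoly (p + 1) * fibPoly q =
      polySign (p + 1) * fibPoly (q - p) := by
  have h := fibPoly_bracket (q - p) p
  rw [show p + (q - p) = q by ring] at h
  rw [polySign_add, polySign_one]
  linear_combination -h

/-- Among the pairs i < j ≤ m, the difference l + 1 occurs m - l times. -/
theorem prod_range_range_sub {M : Type*} [CommMonoid M] (g : ℕ → M) (m : ℕ) :
    ∏ j ∈ Finset.range (m + 1), ∏ i ∈ Finset.range j, g (j - i) =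
      ∏ l ∈ Finset.range (m + 1), g (l + 1) ^ (m - l) := by
  induction m with
  | zero => simp
  | succ m ih =>
    rw [Finset.prod_range_succ, ih, Finset.prod_range_succ _ (m + 1), Nat.sub_self, pow_zero,
      mul_one, ← Finset.prod_range_reflect (fun i => g (m + 1 - i)), ← Finset.prod_mul_distrib]
    refine Finset.prod_congr rfl fun l hl => ?_
    have hl := Finset.mem_range.1 hl
    rw [show m + 1 - (m + 1 - 1 - l) = l + 1 by omega, show m + 1 - l = (m - l) + 1 by omega, pow_succ]

theorem prod_range_eq_prod_Icc {M : Type*} [CommMonoid M] (g : ℕ → M) (m : ℕ) :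
    ∏ l ∈ Finset.range (m + 1), g (l + 1) ^ (m - l) = ∏ l ∈ Finset.Icc 1 m, g l ^ (m + 1 - l) := by
  rw [Finset.prod_range_succ, Nat.sub_self, pow_zero, mul_one, Finset.range_eq_Ico]
  have := Finset.prod_Ico_add' (fun l => g l ^ (m + 1 - l)) 0 m 1
  simp only [Nat.add_sub_add_right] at this
  rw [this]
  rfl

theorem sum_range_range_linear (c k : ℤ) (m : ℕ) :
    ∑ j ∈ Finset.range (m + 1), ∑ i ∈ Finset.range j, (c + k * i) =
      c * ((m + 1).choose 2 : ℕ) + k * ((m + 1).choose 3 : ℕ) := by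
  induction m with
  | zero => simp [Nat.choose]
  | succ m ih =>
    rw [Finset.sum_range_succ, ih, Finset.sum_add_distrib, ← Finset.mul_sum, Finset.sum_const,
      Finset.card_range, ← Nat.cast_sum, Finset.sum_range_id, ← Nat.choose_two_right,
      Nat.choose_succ_succ (m + 1) 1, Nat.choose_succ_succ (m + 1) 2, Nat.choose_one_right]
    push_cast
    ring

theorem prod_polySign_linear (c k : ℤ) (m : ℕ) :
    ∏ j ∈ Finset.range (m + 1), ∏ i ∈ Finset.range j, polySign (c + k * i) =
      polySign (c * ((m + 1).choose 2 : ℕ) + k * ((m + 1).choose 3 : ℕ)) := by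
  simp only [polySign_sum, sum_range_range_linear]

/-- The projective Vandermonde product of pairs of consecutive Fibonacci polynomials whose indices
are in arithmetic progression. -/
theorem prod_fibPoly_bracket (c k : ℤ) (m : ℕ) :
    ∏ j ∈ Finset.range (m + 1), ∏ i ∈ Finset.range j,
      (fibPoly (c + k * i) * fibPoly (c + k * j + 1) - fibPoly (c + k * i + 1) * fibPoly (c + k * j)) =
      polySign ((c + 1) * ((m + 1).choose 2 : ℕ) + k * ((m + 1).choose 3 : ℕ)) *
        ∏ l ∈ Finset.range (m + 1), fibPoly (k * (l + 1)) ^ (m - l) := by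
  have h := prod_range_range_sub (fun l : ℕ => fibPoly (k * l)) m
  push_cast at h
  rw [← h, ← prod_polySign_linear, ← Finset.prod_mul_distrib]
  refine Finset.prod_congr rfl fun j _ => ?_
  rw [← Finset.prod_mul_distrib]
  refine Finset.prod_congr rfl fun i hi => ?_
  have hi := Finset.mem_range.1 hi
  rw [fibPoly_bracket_translate, Nat.cast_sub hi.le, show c + k * i + 1 = c + 1 + k * i by ring]
  congr 2
  ring

/-! ### Determinants of Fibonacci polynomials. -/

theorem det_fibPoly_prod (m : ℕ) (s k n : ℤ) (u v : ℕ → ℤ) :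
    Matrix.det (Matrix.of fun i j : Fin (m + 1) =>
        (∏ f ∈ Finset.Icc ((j : ℕ) + 1) m, fibPoly (s + k * (n + (i : ℕ) + u f))) *
          ∏ g ∈ Finset.Icc 1 (j : ℕ), fibPoly (s + k * (n + (i : ℕ) + v g))) =
      polySign ((s + k * n + 1) * ((m + 1).choose 2 : ℕ) + k * ((m + 1).choose 3 : ℕ)) *
        (∏ l ∈ Finset.Icc 1 m, fibPoly (k * l) ^ (m + 1 - l)) *
        ∏ j ∈ Finset.Icc 1 m, ∏ i ∈ Finset.Icc 1 j,
          (polySign (k * u j) * fibPoly (k * (v i - u j))) := by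
  have h := det_prod_linear m (fun f => fibPoly (k * u f - 1)) (fun f => fibPoly (k * u f))
    (fun f => fibPoly (k * v f - 1)) (fun f => fibPoly (k * v f))
    (fun i => fibPoly (s + k * n + k * i)) (fun i => fibPoly (s + k * n + k * i + 1))
  have h1 := prod_range_eq_prod_Icc (fun l : ℕ => fibPoly (k * l)) m
  push_cast at h1
  simp only [← fibPoly_add] at h
  rw [prod_fibPoly_bracket, h1] at h
  convert h using 6
  · refine Finset.prod_congr rfl fun f _ => ?_
    congr 1
    ring
  · congr 1
    ring_nf
  · rename_i j _ i _
    have := fibPoly_bracket_translate (k * u j - 1) (k * v i - 1)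
    rw [sub_add_cancel, sub_add_cancel] at this
    rw [this]
    congr 2
    ring

theorem det_fibPoly_pow (m : ℕ) (s k n : ℤ) :
    Matrix.det (Matrix.of fun i j : Fin (m + 1) =>
        fibPoly (s + k * (n + (i : ℕ) + (j : ℕ))) ^ m) =
      polySign ((s + k * n + 1) * ((m + 1).choose 2 : ℕ)) *
        ∏ i ∈ Finset.range (m + 1),
          ((m.choose i : ℝ[X]) * fibPoly ((i + 1) * k) ^ (2 * (m - i))) := by
  have h := det_pow_linear m (fun j => fibPoly (k * j - 1)) (fun j => fibPoly (k * j))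
    (fun i => fibPoly (s + k * n + k * i)) (fun i => fibPoly (s + k * n + k * i + 1))
  -- The column Vandermonde starts at index -1, so its sign is (-1)^{k·C(m+1,3)}, which cancels the
  -- same sign from the rows.
  have h1 := prod_fibPoly_bracket (-1) k m
  simp only [← fibPoly_add] at h
  rw [prod_fibPoly_bracket] at h
  simp only [show ∀ t : ℕ, (-1 : ℤ) + k * t = k * t - 1 by intro t; ring, sub_add_cancel] at h1
  rw [h1] at h
  have h2 : (Matrix.of fun i j : Fin (m + 1) =>
        fibPoly (s + k * (n + (i : ℕ) + (j : ℕ))) ^ m) =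
      Matrix.of fun i j : Fin (m + 1) => fibPoly (s + k * n + k * (i : ℕ) + k * (j : ℕ)) ^ m := by
    ext1 i j
    simp only [Matrix.of_apply]
    congr 2
    ring
  rw [h2, h, Finset.prod_mul_distrib]
  have h3 : ∏ i ∈ Finset.range (m + 1), fibPoly ((i + 1) * k) ^ (2 * (m - i)) =
      (∏ i ∈ Finset.range (m + 1), fibPoly (k * (i + 1)) ^ (m - i)) *
        ∏ i ∈ Finset.range (m + 1), fibPoly (k * (i + 1)) ^ (m - i) := by
    rw [← Finset.prod_mul_distrib]
    refine Finset.prod_congr rfl fun i _ => ?_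
    rw [← pow_add, ← two_mul, mul_comm k]
  rw [h3, polySign_add]
  have h4 := polySign_mul_self (k * ((m + 1).choose 3 : ℕ))
  rw [show ((-1 : ℤ) + 1) * ((m + 1).choose 2 : ℕ) + k * ((m + 1).choose 3 : ℕ) =
    k * ((m + 1).choose 3 : ℕ) by ring]
  linear_combination (∏ i ∈ Finset.range (m + 1), (m.choose i : ℝ[X])) *
    polySign ((s + k * n + 1) * ((m + 1).choose 2 : ℕ)) *
    (∏ i ∈ Finset.range (m + 1), fibPoly (k * (i + 1)) ^ (m - i)) ^ 2 * h4

/-- Column j omits exactly the index j from 0, …, m: this is what remains of 1/F_{s+k(n+i+j)} once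
row i is multiplied by all its denominators. -/
theorem det_fibPoly_prod_compl (m : ℕ) (s k n : ℤ) :
    Matrix.det (Matrix.of fun i j : Fin (m + 1) =>
        (∏ f ∈ Finset.Icc ((j : ℕ) + 1) m, fibPoly (s + k * (n + (i : ℕ) + (f : ℕ)))) *
          ∏ g ∈ Finset.range j, fibPoly (s + k * (n + (i : ℕ) + (g : ℕ)))) =
      polySign ((s + k * n) * ((m + 1).choose 2 : ℕ)) *
        ∏ i ∈ Finset.range (m + 1), fibPoly (k * (i + 1)) ^ (2 * (m - i)) := by
  have h := det_fibPoly_prod m s k n (fun f => f) (fun g => g - 1)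
  rw [prod_Icc_Icc_eq_prod_range] at h
  simp only [prod_Icc_one_eq_prod_range (fun g => fibPoly _), Nat.cast_add, Nat.cast_one,
    add_sub_cancel_right] at h
  rw [h, ← prod_range_eq_prod_Icc (fun l : ℕ => fibPoly (k * l))]
  have h1 : ∏ j ∈ Finset.range (m + 1), ∏ i ∈ Finset.range j,
      (polySign (k * j) * fibPoly (k * ((i : ℤ) - j))) =
      ∏ j ∈ Finset.range (m + 1), ∏ i ∈ Finset.range j,
        (polySign (1 + k * i) * fibPoly (k * ((j - i : ℕ) : ℤ))) := by
    refine Finset.prod_congr rfl fun j _ => Finset.prod_congr rfl fun i hi => ?_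
    have hi := Finset.mem_range.1 hi
    rw [Nat.cast_sub hi.le, show k * ((i : ℤ) - j) = -(k * (j - i)) by ring, fibPoly_neg,
      ← mul_assoc, ← polySign_add]
    congr 1
    exact polySign_eq_of_sub_eq (k * j - k * i) (by ring)
  rw [h1]
  simp only [Finset.prod_mul_distrib]
  rw [prod_range_range_sub (fun l : ℕ => fibPoly (k * l)), prod_polySign_linear, mul_mul_mul_comm,
    ← polySign_add, ← Finset.prod_mul_distrib]
  congr 1
  · exact polySign_eq_of_sub_eq (((m + 1).choose 2 : ℕ) + k * ((m + 1).choose 3 : ℕ)) (by ring)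
  · refine Finset.prod_congr rfl fun i _ => ?_
    rw [← pow_add, ← two_mul]
    push_cast
    rfl

/-- A general `φ` covers both the embedding into rational functions and evaluation at a real point.
-/
theorem det_one_div_fibPoly {K : Type*} [Field K] (φ : ℝ[X] →+* K) (m : ℕ) (s k n : ℤ)
    (hne : ∀ i j : Fin (m + 1), φ (fibPoly (s + k * (n + (i : ℕ) + (j : ℕ)))) ≠ 0) :
    Matrix.det (Matrix.of fun i j : Fin (m + 1) =>
        1 / φ (fibPoly (s + k * (n + (i : ℕ) + (j : ℕ))))) =
      φ (polySign ((s + k * n) * ((m + 1).choose 2 : ℕ)) *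
          ∏ i ∈ Finset.range (m + 1), fibPoly (k * (i + 1)) ^ (2 * (m - i))) /
        φ (∏ i ∈ Finset.range (m + 1), ∏ j ∈ Finset.range (m + 1),
          fibPoly (s + k * (n + i + j))) := by
  have hne' : φ (∏ i ∈ Finset.range (m + 1), ∏ j ∈ Finset.range (m + 1),
      fibPoly (s + k * (n + i + j))) ≠ 0 := by
    simp only [map_prod]
    refine Finset.prod_ne_zero_iff.2 fun i hi => Finset.prod_ne_zero_iff.2 fun j hj => ?_
    exact hne ⟨i, Finset.mem_range.1 hi⟩ ⟨j, Finset.mem_range.1 hj⟩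
  rw [eq_div_iff hne', ← det_fibPoly_prod_compl, RingHom.map_det, mul_comm, map_prod,
    ← Fin.prod_univ_eq_prod_range
      (fun i => φ (∏ j ∈ Finset.range (m + 1), fibPoly (s + k * (n + i + j)))),
    ← Matrix.det_mul_column]
  congr 1
  ext i j
  simp only [RingHom.mapMatrix_apply, Matrix.map_apply, Matrix.of_apply]
  rw [← Finset.prod_range_mul_prod_Ico _ (show (j : ℕ) + 1 ≤ m + 1 by omega),
    Finset.prod_range_succ, map_mul, map_mul, map_mul, mul_one_div, div_eq_iff (hne i j),
    show Finset.Ico ((j : ℕ) + 1) (m + 1) = Finset.Icc ((j : ℕ) + 1) m from rfl]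
  ring

theorem fibPolyRising_natCast (n : ℤ) (t : ℕ) :
    fibPolyRising n t = ∏ i ∈ Finset.range t, fibPoly (n + i) := by
  rw [fibPolyRising, Int.toNat_natCast]

/-- For every j ≤ e ≤ m the index window [j, j+m) contains [e, m), which is common to all columns;
[j, e) lies to its left and [m, m+j) to its right. -/
theorem fibPolyRising_eq_mul {n : ℤ} {m e j : ℕ} (hj : j ≤ e) (he : e ≤ m) :
    fibPolyRising (n + j) m =
      fibPolyRising (n + e) (m - e : ℕ) * ((∏ f ∈ Finset.Ico j e, fibPoly (n + f)) *
        ∏ g ∈ Finset.range j, fibPoly (n + (m + g))) := by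
  have key (a b : ℕ) (t : ℕ) (hb : b = a + t) :
      ∏ i ∈ Finset.range t, fibPoly (n + a + i) = ∏ i ∈ Finset.Ico a b, fibPoly (n + i) := by
    rw [Finset.prod_Ico_eq_prod_range, hb, Nat.add_sub_cancel_left]
    push_cast
    simp only [add_assoc]
  have h1 := key m (m + j) j rfl
  simp only [add_assoc n] at h1
  rw [fibPolyRising_natCast, fibPolyRising_natCast, key j (m + j) m (by omega),
    key e m (m - e) (by omega), h1, ← Finset.prod_Ico_consecutive _ (hj.trans he) (by omega : m ≤ m + j),
    ← Finset.prod_Ico_consecutive _ hj he]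
  ring

theorem prod_polySign_pred (e : ℕ) :
    ∏ j ∈ Finset.range (e + 1), ∏ _i ∈ Finset.range j, polySign ((j : ℤ) - 1) = 1 := by
  refine Finset.prod_eq_one fun j _ => ?_
  rw [polySign_sum, Finset.sum_const, Finset.card_range, nsmul_eq_mul, polySign,
    Even.neg_one_zpow (Int.even_mul_pred_self _), C_1]

theorem det_fibPolyRising_of_le {m e : ℕ} (he : e ≤ m) (n : ℤ) :
    Matrix.det (Matrix.of fun i j : Fin (e + 1) => fibPolyRising (n + (i : ℕ) + (j : ℕ)) m) =
      polySign (n * ((e + 1).choose 2 : ℕ) + ((e + 2).choose 3 : ℕ)) *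
        (∏ i ∈ Finset.Icc 1 e, (fibPoly i * fibPoly (m + 1 - i)) ^ (e + 1 - i)) *
        ∏ i ∈ Finset.range (e + 1), fibPolyRising (n + i + e) (m - e : ℕ) := by
  -- The shifts f - 1 and m + (g - 1) run through the left and right blocks of
  -- `fibPolyRising_eq_mul`.
  have h := det_fibPoly_prod e 0 1 n (fun f => f - 1) (fun g => m + (g - 1))
  rw [prod_Icc_Icc_eq_prod_range] at h
  have h1 (i : ℤ) (j : ℕ) : ∏ f ∈ Finset.Icc (j + 1) e, fibPoly (n + i + (f - 1)) =
      ∏ f ∈ Finset.Ico j e, fibPoly (n + i + f) := by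
    have := Finset.prod_Ico_add' (fun f : ℕ => fibPoly (n + i + (f - 1))) j e 1
    push_cast at this
    simp only [add_sub_cancel_right] at this
    rw [this]
    rfl
  simp only [prod_Icc_one_eq_prod_range (fun g => fibPoly _), Nat.cast_add, Nat.cast_one,
    add_sub_cancel_right, zero_add, one_mul, h1] at h
  have h2 : (Matrix.of fun i j : Fin (e + 1) => fibPolyRising (n + (i : ℕ) + (j : ℕ)) m) =
      Matrix.of fun i j : Fin (e + 1) => fibPolyRising (n + (i : ℕ) + e) (m - e : ℕ) *
        (Matrix.of fun i j : Fin (e + 1) =>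
          (∏ f ∈ Finset.Ico (j : ℕ) e, fibPoly (n + (i : ℕ) + f)) *
            ∏ g ∈ Finset.range j, fibPoly (n + (i : ℕ) + (m + g))) i j := by
    ext1 i j
    simp only [Matrix.of_apply]
    exact fibPolyRising_eq_mul (by omega) he
  rw [h2, Matrix.det_mul_column, h,
    Fin.prod_univ_eq_prod_range (fun i => fibPolyRising (n + i + e) (m - e : ℕ)), mul_comm]
  congr 1
  have h3 : ∏ j ∈ Finset.range (e + 1), ∏ i ∈ Finset.range j,
      (polySign ((j : ℤ) - 1) * fibPoly ((m : ℤ) + i - (j - 1))) =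
      ∏ i ∈ Finset.Icc 1 e, fibPoly (m + 1 - i) ^ (e + 1 - i) := by
    rw [← prod_range_eq_prod_Icc (fun i : ℕ => fibPoly (m + 1 - i)),
      ← prod_range_range_sub (fun i : ℕ => fibPoly (m + 1 - i))]
    simp only [Finset.prod_mul_distrib, prod_polySign_pred, one_mul]
    refine Finset.prod_congr rfl fun j _ => Finset.prod_congr rfl fun i hi => ?_
    have hi := Finset.mem_range.1 hi
    rw [Nat.cast_sub hi.le]
    congr 1
    ring
  rw [h3, mul_assoc, ← Finset.prod_mul_distrib]
  congr 1
  · rw [Nat.choose_succ_succ (e + 1) 2]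
    push_cast
    congr 1
    ring
  · simp only [mul_pow]

theorem det_fibPolyRising_of_lt {m d : ℕ} (h : m + 1 < d) (n : ℤ) :
    Matrix.det (Matrix.of fun i j : Fin d => fibPolyRising (n + (i : ℕ) + (j : ℕ)) m) = 0 := by
  have := det_binaryForm_eq_zero h
    (fun j x y => ∏ t ∈ Finset.range m, (fibPoly (j + t - 1) * x + fibPoly (j + t) * y))
    (fun j => by
      have := IsBinaryForm.prod_linear (Finset.range m) (fun t => fibPoly (j + t - 1))
        (fun t => fibPoly (j + t))
      rwa [Finset.card_range] at this)
    (fun i => fibPoly (n + i)) (fun i => fibPoly (n + i + 1))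
  simp only [← fibPoly_add] at this
  simpa only [fibPolyRising_natCast, add_assoc] using this

/-! ### Fibonacci numbers and the final assembly. -/

theorem eval_one_fibPoly_natCast (n : ℕ) : (fibPoly n).eval 1 = Nat.fib n := by
  induction n using Nat.twoStepInduction with
  | zero => simp [fibPoly_zero]
  | one => simp [fibPoly_one]
  | more n ih1 ih2 =>
    push_cast at ih2 ⊢
    rw [fibPoly_add_two, Nat.fib_add_two]
    simp [ih1, ih2, add_comm]

theorem corollary2 (m d : ℕ) (hm : 1 ≤ m) (hd : 1 ≤ d) (s k n : ℤ) (u v : ℕ → ℤ) :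
    -- powers
    (Matrix.det (Matrix.of fun i j : Fin (m + 1) =>
          fibPoly (s + k * (n + (i : ℕ) + (j : ℕ))) ^ m) =
        polySign ((s + k * n + 1) * ((m + 1).choose 2 : ℕ)) *
          ∏ i ∈ Finset.range (m + 1),
            ((m.choose i : ℝ[X]) * fibPoly ((i + 1) * k) ^ (2 * (m - i)))) ∧
    -- products
    (Matrix.det (Matrix.of fun i j : Fin (m + 1) =>
          (∏ f ∈ Finset.Icc ((j : ℕ) + 1) m, fibPoly (s + k * (n + (i : ℕ) + u f))) *
            ∏ g ∈ Finset.Icc 1 (j : ℕ), fibPoly (s + k * (n + (i : ℕ) + v g))) =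
        polySign ((s + k * n + 1) * ((m + 1).choose 2 : ℕ) + k * ((m + 1).choose 3 : ℕ)) *
          (∏ l ∈ Finset.Icc 1 m, fibPoly (k * l) ^ (m + 1 - l)) *
          ∏ j ∈ Finset.Icc 1 m, ∏ i ∈ Finset.Icc 1 j,
            (polySign (k * u j) * fibPoly (k * (v i - u j)))) ∧
    -- reciprocals, in the field of rational functions
    ((∀ i j : Fin (m + 1), fibPoly (s + k * (n + (i : ℕ) + (j : ℕ))) ≠ 0) →
      Matrix.det (Matrix.of fun i j : Fin (m + 1) =>
          1 / algebraMap ℝ[X] (RatFunc ℝ) (fibPoly (s + k * (n + (i : ℕ) + (j : ℕ))))) =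
        algebraMap ℝ[X] (RatFunc ℝ)
            (polySign ((s + k * n) * ((m + 1).choose 2 : ℕ)) *
              ∏ i ∈ Finset.range (m + 1), fibPoly (k * (i + 1)) ^ (2 * (m - i))) /
          algebraMap ℝ[X] (RatFunc ℝ)
            (∏ i ∈ Finset.range (m + 1), ∏ j ∈ Finset.range (m + 1),
              fibPoly (s + k * (n + i + j)))) ∧
    -- reciprocals, at every real point where the denominators do not vanish
    (∀ x : ℝ,
      (∀ i j : Fin (m + 1), (fibPoly (s + k * (n + (i : ℕ) + (j : ℕ)))).eval x ≠ 0) →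
      Matrix.det (Matrix.of fun i j : Fin (m + 1) =>
          1 / (fibPoly (s + k * (n + (i : ℕ) + (j : ℕ)))).eval x) =
        ((-1 : ℝ) ^ ((s + k * n) * ((m + 1).choose 2 : ℕ)) *
            ∏ i ∈ Finset.range (m + 1), (fibPoly (k * (i + 1))).eval x ^ (2 * (m - i))) /
          ∏ i ∈ Finset.range (m + 1), ∏ j ∈ Finset.range (m + 1),
            (fibPoly (s + k * (n + i + j))).eval x) ∧
    -- rising powers
    (Matrix.det (Matrix.of fun i j : Fin d =>
          fibPolyRising (n + (i : ℕ) + (j : ℕ)) m) =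
        polySign (n * (d.choose 2 : ℕ) + ((d + 1).choose 3 : ℕ)) *
          (∏ i ∈ Finset.Icc 1 (d - 1), (fibPoly i * fibPoly (m + 1 - i)) ^ (d - i)) *
          ∏ i ∈ Finset.Icc (d - 1) (2 * (d - 1)), fibPolyRising (n + i) (m + 1 - d)) ∧
    -- the case of Fibonacci numbers in the reciprocal identity
    (∀ N : ℕ, 1 ≤ N →
      Matrix.det (Matrix.of fun i j : Fin (m + 1) =>
          1 / (Nat.fib (N + (i : ℕ) + (j : ℕ)) : ℝ)) =
        ((-1 : ℝ) ^ (N * (m + 1).choose 2) *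
            ∏ i ∈ Finset.range (m + 1), (Nat.fib (i + 1) : ℝ) ^ (2 * (m - i))) /
          ∏ i ∈ Finset.range (m + 1), ∏ j ∈ Finset.range (m + 1),
            (Nat.fib (N + i + j) : ℝ)) := by
  have hev (x : ℝ) (s k n : ℤ) (hx : ∀ i j : Fin (m + 1),
      (fibPoly (s + k * (n + (i : ℕ) + (j : ℕ)))).eval x ≠ 0) :
      Matrix.det (Matrix.of fun i j : Fin (m + 1) =>
          1 / (fibPoly (s + k * (n + (i : ℕ) + (j : ℕ)))).eval x) =
        ((-1 : ℝ) ^ ((s + k * n) * ((m + 1).choose 2 : ℕ)) *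
            ∏ i ∈ Finset.range (m + 1), (fibPoly (k * (i + 1))).eval x ^ (2 * (m - i))) /
          ∏ i ∈ Finset.range (m + 1), ∏ j ∈ Finset.range (m + 1),
            (fibPoly (s + k * (n + i + j))).eval x := by
    have h := det_one_div_fibPoly (evalRingHom x) m s k n hx
    simpa only [map_mul, map_prod, map_pow, coe_evalRingHom, polySign, eval_C] using h
  refine ⟨det_fibPoly_pow m s k n, det_fibPoly_prod m s k n u v, fun hne => ?_,
    fun x hx => hev x s k n hx, ?_, fun N hN => ?_⟩
  · refine det_one_div_fibPoly (algebraMap ℝ[X] (RatFunc ℝ)) m s k n fun i j => ?_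
    rw [Ne, FaithfulSMul.algebraMap_eq_zero_iff]
    exact hne i j
  · obtain ⟨e, rfl⟩ : ∃ e, d = e + 1 := ⟨d - 1, by omega⟩
    rw [Nat.add_sub_cancel]
    rcases le_or_gt e m with he | he
    · rw [det_fibPolyRising_of_le he]
      congr 1
      have h1 : (m : ℤ) + 1 - ((e + 1 : ℕ) : ℤ) = ((m - e : ℕ) : ℤ) := by omega
      have h2 : Finset.Icc e (2 * e) = Finset.Ico (0 + e) (e + 1 + e) := by
        ext; simp only [Finset.mem_Icc, Finset.mem_Ico]; omega
      rw [h1, h2, ← Finset.prod_Ico_add' (fun i : ℕ => fibPolyRising (n + i) (m - e : ℕ)),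
        Finset.range_eq_Ico]
      push_cast
      simp only [add_assoc]
    -- On the right, the factor i = m + 1 contains F_0 = 0 to a positive power.
    · rw [det_fibPolyRising_of_lt (by omega), Finset.prod_eq_zero (i := m + 1), mul_zero, zero_mul]
      · simp only [Finset.mem_Icc]; omega
      · push_cast
        rw [sub_self, fibPoly_zero, mul_zero, zero_pow (by omega)]
  · have hcast (a : ℤ) (b : ℕ) (hab : a = b) : (fibPoly a).eval 1 = Nat.fib b := by
      rw [hab, eval_one_fibPoly_natCast]
    have hfib (i j : ℕ) : (fibPoly (0 + 1 * ((N : ℤ) + i + j))).eval 1 = Nat.fib (N + i + j) :=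
      hcast _ _ (by push_cast; ring)
    have hfib' (i : ℕ) : (fibPoly (1 * ((i : ℤ) + 1))).eval 1 = Nat.fib (i + 1) :=
      hcast _ _ (by push_cast; ring)
    have h := hev 1 0 1 N (fun i j => by
      rw [hfib, Nat.cast_ne_zero]
      exact (Nat.fib_pos.2 (by omega)).ne')
    simp only [hfib, hfib'] at h
    rw [h, zero_add, one_mul, ← Nat.cast_mul, zpow_natCast]
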